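/- Let $n\ge 3$ be an integer, let $G$ be a group isomorphic to the dihedral group $D_{2n}$ of order $2n$, and let $S\subseteq G\setminus\{1\}$ be a subset with $S=S^{-1}$ that is a union of conjugacy classes of $G$. Let $\Gamma=\mathrm{Cay}(G,S)$ be the graph with vertex set $G$ in which $x,y$ are adjacent if and only if $yx^{-1}\in S$, and suppose that $\Gamma$ is connected (so $\Gamma$ is a connected inner-automorphic Cayley graph on $G$). For $s\ge 1$, an $s$-arc of $\Gamma$ is a sequence $(u_0,\dots,u_s)$ of vertices such that $u_i$ is adjacent to $u_{i+1}$ for $0\le i\le s-1$ and $u_{j-1}\ne u_{j+1}$ for $1\le j\le s-1$; $\Gamma$ is $s$-arc-transitive if its full automorphism group is transitive on the vertices and on the $s$-arcs of $\Gamma$. Write $K_m$ for the complete graph on $m$ vertices, $K_{n,n}$ for the complete bipartite graph with two parts of size $n$, and $K_{n,n}-nK_2$ for $K_{n,n}$ with the edges of a perfect matching removed. Then: (i) $\Gamma$ is at most $3$-arc-transitive, that is, $\Gamma$ is not $s$-arc-transitive for any $s\ge 4$; (ii) $\Gamma$ is $3$-arc-transitive if and only if $\Gamma\cong K_{n,n}$;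 (iii) $\Gamma$ is $2$-arc-transitive if and only if $\Gamma\cong K_{2n}$, or $\Gamma\cong K_{n,n}$, or $n\ge 4$ and $\Gamma\cong K_{n,n}-nK_2$. -/

import Mathlib

namespace InnerCayley

/-- The Cayley graph `Cay(G, S)` of an inverse-closed set `S` not containing `1`:
`x` and `y` are adjacent iff `y * x⁻¹ ∈ S`. -/
def Cay {G : Type*} [Group G] (S : Set G) (h1 : (1 : G) ∉ S) (hinv : S⁻¹ = S) :
    SimpleGraph G where
  Adj x y := y * x⁻¹ ∈ S
  symm := ⟨fun x y h => by
    rw [← hinv, Set.mem_inv]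
    simpa using h⟩
  loopless := ⟨fun x h => h1 (by simpa using h)⟩

/-- `S` is a union of conjugacy classes of `G`, i.e. `Cay(G, S)` is inner-automorphic. -/
def IsUnionOfConjClasses {G : Type*} [Group G] (S : Set G) : Prop :=
  ∃ C : Set (ConjClasses G), S = ⋃ c ∈ C, c.carrier

/-- `u = (u₀, …, u_s)` is an `s`-arc: consecutive vertices are adjacent, and vertices two
steps apart are distinct. -/
def IsArcSeq {V : Type*} (Γ : SimpleGraph V) (s : ℕ) (u : Fin (s + 1) → V) : Prop :=
  (∀ i : Fin s, Γ.Adj (u i.castSucc) (u i.succ)) ∧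
    ∀ i j : Fin (s + 1), (j : ℕ) = i + 2 → u i ≠ u j

/-- The full automorphism group of `Γ` is transitive on vertices. -/
def VertexTransitive {V : Type*} (Γ : SimpleGraph V) : Prop :=
  ∀ x y : V, ∃ φ : Γ ≃g Γ, φ x = y

/-- `Γ` is `s`-arc-transitive: its full automorphism group is transitive on vertices and on
`s`-arcs. -/
def ArcTransitive {V : Type*} (Γ : SimpleGraph V) (s : ℕ) : Prop :=
  VertexTransitive Γ ∧
    ∀ u v : Fin (s + 1) → V, IsArcSeq Γ s u → IsArcSeq Γ s v →
      ∃ φ : Γ ≃g Γ, ∀ i, φ (u i) = v i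

/-- `K_{n,n} - nK₂`: the complete bipartite graph with the edges of a perfect matching
deleted. -/
def bipartiteMinusMatching (n : ℕ) : SimpleGraph (Fin n ⊕ Fin n) :=
  (completeBipartiteGraph (Fin n) (Fin n)).deleteEdges
    {e | ∃ i : Fin n, e = s(Sum.inl i, Sum.inr i)}

end InnerCayley

/-!
A `2`-arc-transitive connected normal Cayley graph `Γ` of the dihedral group is determined by an
elementary argument about its connection set `S`.

If `Γ` has a triangle, then every `2`-arc lies in a triangle and `Γ` is complete
(`ArcTransitive.eq_top_of_triangle`). Otherwise no product of two elements of `S` lies in `S`.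
By connectedness `S` contains a reflection, and being normal it contains, with `sr i`, all
`sr (i + 2j)`. If all reflections are in `S`, then no rotation is, and `Γ` is `K_{n,n}`.

In the remaining case not every element of `ZMod n` is even, exactly one of the two classes of
reflections is contained in `S`, and `S` avoids the subgroup `H` of index two formed by the even
rotations and the other reflections. For a reflection `u ∈ H` the neighbourhoods of `1` and `u`
cover the complement of `H`. All nontrivial elements of `H` are at distance two from `1`, so
they are conjugate under the stabiliser of `1`, and comparing cardinalities shows that the
neighbourhoods of `1` and any even rotation `r z ≠ 1` also cover it
(`mem_or_mem_of_arcTransitive`). Hence at most one element of the complement of `H` is missing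
from `S`, and `Γ` is `K_{n,n}` or `K_{n,n} - nK₂` (`classification_of_arcTransitive_two`).

Since all vertices of `Γ` have degree at least two, arcs can be prolonged and `s`-arc-transitivity
implies `t`-arc-transitivity for `t ≤ s` (`ArcTransitive.mono`); the rest of the statement is a
check on the three model graphs, where permutations of the vertices supply the automorphisms and
arcs with equal or nonadjacent ends obstruct higher transitivity.
-/

namespace InnerCayley

open SimpleGraph

/-! ### Arcs and arc-transitivity -/

section Arcs

variable {V W : Type*} {Γ : SimpleGraph V} {Γ' : SimpleGraph W}

lemma isArcSeq_two_iff {x y z : V} :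
    IsArcSeq Γ 2 ![x, y, z] ↔ Γ.Adj x y ∧ Γ.Adj y z ∧ x ≠ z := by
  simp [IsArcSeq, Fin.forall_fin_succ, and_assoc]

lemma isArcSeq_three_iff {x y z w : V} :
    IsArcSeq Γ 3 ![x, y, z, w] ↔
      Γ.Adj x y ∧ Γ.Adj y z ∧ Γ.Adj z w ∧ x ≠ z ∧ y ≠ w := by
  simp [IsArcSeq, Fin.forall_fin_succ, and_assoc]

lemma isArcSeq_four_iff {x y z w t : V} :
    IsArcSeq Γ 4 ![x, y, z, w, t] ↔
      Γ.Adj x y ∧ Γ.Adj y z ∧ Γ.Adj z w ∧ Γ.Adj w t ∧ x ≠ z ∧ y ≠ w ∧ z ≠ t := by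
  simp [IsArcSeq, Fin.forall_fin_succ, and_assoc]

lemma ArcTransitive.exists_two (h : ArcTransitive Γ 2) {x y z x' y' z' : V}
    (hxy : Γ.Adj x y) (hyz : Γ.Adj y z) (hxz : x ≠ z)
    (hxy' : Γ.Adj x' y') (hyz' : Γ.Adj y' z') (hxz' : x' ≠ z') :
    ∃ φ : Γ ≃g Γ, φ x = x' ∧ φ y = y' ∧ φ z = z' := by
  obtain ⟨φ, hφ⟩ := h.2 ![x, y, z] ![x', y', z'] (isArcSeq_two_iff.2 ⟨hxy, hyz, hxz⟩)
    (isArcSeq_two_iff.2 ⟨hxy', hyz', hxz'⟩)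
  exact ⟨φ, hφ 0, hφ 1, hφ 2⟩

lemma arcTransitive_two_of (hv : VertexTransitive Γ)
    (h : ∀ x y z x' y' z' : V, Γ.Adj x y → Γ.Adj y z → x ≠ z →
      Γ.Adj x' y' → Γ.Adj y' z' → x' ≠ z' → ∃ φ : Γ ≃g Γ, φ x = x' ∧ φ y = y' ∧ φ z = z') :
    ArcTransitive Γ 2 := by
  refine ⟨hv, fun u v hu hv => ?_⟩
  obtain ⟨φ, h0, h1, h2⟩ := h (u 0) (u 1) (u 2) (v 0) (v 1) (v 2) (hu.1 0) (hu.1 1)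
    (hu.2 0 2 rfl) (hv.1 0) (hv.1 1) (hv.2 0 2 rfl)
  refine ⟨φ, fun i => ?_⟩
  fin_cases i
  exacts [h0, h1, h2]

lemma ArcTransitive.congr (e : Γ ≃g Γ') {s : ℕ} (h : ArcTransitive Γ s) :
    ArcTransitive Γ' s := by
  have harc : ∀ u : Fin (s + 1) → W, IsArcSeq Γ' s u → IsArcSeq Γ s (e.symm ∘ u) :=
    fun u hu => ⟨fun i => e.symm.map_adj_iff.2 (hu.1 i),
      fun i j hij he => hu.2 i j hij (e.symm.injective he)⟩
  refine ⟨fun x y => ?_, fun u v hu hv => ?_⟩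
  · obtain ⟨φ, hφ⟩ := h.1 (e.symm x) (e.symm y)
    exact ⟨(e.symm.trans φ).trans e, by simp [hφ]⟩
  · obtain ⟨φ, hφ⟩ := h.2 _ _ (harc u hu) (harc v hv)
    refine ⟨(e.symm.trans φ).trans e, fun i => ?_⟩
    have := hφ i
    simp only [Function.comp_apply] at this
    simp [this]

/-- An arc can be prolonged when no vertex has degree less than two. -/
lemma IsArcSeq.exists_snoc (hdeg : ∀ x y : V, ∃ z, Γ.Adj x z ∧ z ≠ y) {s : ℕ}
    {u : Fin (s + 1) → V} (hu : IsArcSeq Γ s u) :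
    ∃ z, IsArcSeq Γ (s + 1) (Fin.snoc u z : Fin (s + 2) → V) := by
  -- For `s = 0` the truncated index `s - 1` is harmless: it only forbids one more vertex.
  obtain ⟨z, hz, hne⟩ := hdeg (u (Fin.last s)) (u ⟨s - 1, by omega⟩)
  refine ⟨z, fun i => ?_, fun i j hij => ?_⟩
  · refine Fin.lastCases ?_ (fun i => ?_) i
    · rw [Fin.snoc_castSucc, Fin.succ_last, Fin.snoc_last]
      exact hz
    · rw [Fin.snoc_castSucc, Fin.succ_castSucc, Fin.snoc_castSucc]
      exact hu.1 i
  · have hi : i ≠ Fin.last _ := by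
      rintro rfl
      have := j.2
      simp at hij
      omega
    obtain ⟨i, rfl⟩ := Fin.exists_castSucc_eq.2 hi
    rw [Fin.snoc_castSucc]
    revert hij
    refine Fin.lastCases (fun hij => ?_) (fun j hij => ?_) j
    · rw [Fin.snoc_last]
      have : i = ⟨s - 1, by omega⟩ := by
        ext
        simp at hij ⊢
        omega
      rw [this]
      exact hne.symm
    · rw [Fin.snoc_castSucc]
      exact hu.2 i j (by simpa using hij)

lemma ArcTransitive.mono (hdeg : ∀ x y : V, ∃ z, Γ.Adj x z ∧ z ≠ y) {s t : ℕ} (hts : t ≤ s)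
    (h : ArcTransitive Γ s) : ArcTransitive Γ t := by
  induction s, hts using Nat.le_induction with
  | base => exact h
  | succ s _ ih =>
    refine ih ⟨h.1, fun u v hu hv => ?_⟩
    obtain ⟨z, hz⟩ := hu.exists_snoc hdeg
    obtain ⟨w, hw⟩ := hv.exists_snoc hdeg
    obtain ⟨φ, hφ⟩ := h.2 _ _ hz hw
    exact ⟨φ, fun i => by simpa using hφ i.castSucc⟩

/-- If some `2`-arc closes up to a triangle, then all do, so that being adjacent or equal is
transitive. -/
lemma ArcTransitive.eq_top_of_triangle (h : ArcTransitive Γ 2) (hc : Γ.Connected) {x y z : V}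
    (hxy : Γ.Adj x y) (hyz : Γ.Adj y z) (hxz : Γ.Adj x z) : Γ = ⊤ := by
  have key : ∀ a b : V, Γ.Walk a b → a = b ∨ Γ.Adj a b := by
    intro a b p
    induction p with
    | nil => exact Or.inl rfl
    | @cons a c b hac _ ih =>
      rcases ih with rfl | hcb
      · exact Or.inr hac
      · by_cases hab : a = b
        · exact Or.inl hab
        · obtain ⟨φ, h0, -, h2⟩ := h.exists_two hxy hyz hxz.ne hac hcb hab
          right
          rw [← h0, ← h2]
          exact φ.map_adj_iff.2 hxz
  ext a b
  rw [top_adj]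
  refine ⟨fun h => h.ne, fun hne => ?_⟩
  obtain ⟨p⟩ := hc.preconnected a b
  exact (key a b p).resolve_left hne

end Arcs

/-! ### Arc-transitivity of the model graphs -/

lemma exists_perm_two {α : Type*} {a b a' b' : α} (h : a ≠ b) (h' : a' ≠ b') :
    ∃ σ : Equiv.Perm α, σ a = a' ∧ σ b = b' := by
  have := Equiv.Perm.isMultiplyPretransitive α 2
  exact MulAction.is_two_pretransitive_iff.1 this h h'

lemma exists_perm_three {α : Type*} {a b c a' b' c' : α} (hab : a ≠ b) (hbc : b ≠ c)
    (hac : a ≠ c) (hab' : a' ≠ b') (hbc' : b' ≠ c') (hac' : a' ≠ c') :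
    ∃ σ : Equiv.Perm α, σ a = a' ∧ σ b = b' ∧ σ c = c' := by
  have := Equiv.Perm.isMultiplyPretransitive α 3
  rw [MulAction.isMultiplyPretransitive_iff] at this
  obtain ⟨σ, hσ⟩ := this ⟨![a, b, c], by
      intro i j
      fin_cases i <;> fin_cases j <;> simp [hab, hbc, hac, hab.symm, hbc.symm, hac.symm]⟩
    ⟨![a', b', c'], by
      intro i j
      fin_cases i <;> fin_cases j <;> simp [hab', hbc', hac', hab'.symm, hbc'.symm, hac'.symm]⟩
  exact ⟨σ, DFunLike.congr_fun hσ 0, DFunLike.congr_fun hσ 1, DFunLike.congr_fun hσ 2⟩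

/-- A permutation of the vertices, as an automorphism of the complete graph. -/
def topIso {α : Type*} (σ : Equiv.Perm α) : (⊤ : SimpleGraph α) ≃g (⊤ : SimpleGraph α) where
  toEquiv := σ
  map_rel_iff' := by simp

lemma vertexTransitive_top {α : Type*} : VertexTransitive (⊤ : SimpleGraph α) := by
  classical
  exact fun x y => ⟨topIso (Equiv.swap x y), Equiv.swap_apply_left x y⟩

lemma arcTransitive_two_top {α : Type*} : ArcTransitive (⊤ : SimpleGraph α) 2 := by
  refine arcTransitive_two_of vertexTransitive_top
    fun x y z x' y' z' hxy hyz hxz hxy' hyz' hxz' => ?_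
  obtain ⟨σ, hσ⟩ := exists_perm_three hxy.ne hyz.ne hxz hxy'.ne hyz'.ne hxz'
  exact ⟨topIso σ, hσ⟩

lemma not_arcTransitive_three_completeGraph {m : ℕ} (hm : 4 ≤ m) :
    ¬ ArcTransitive (completeGraph (Fin m)) 3 := by
  intro h
  let v (k : Fin 4) : Fin m := Fin.castLE hm k
  have hv : Function.Injective v := Fin.castLE_injective hm
  obtain ⟨φ, hφ⟩ := h.2 ![v 0, v 1, v 2, v 0] ![v 0, v 1, v 2, v 3]
    (isArcSeq_three_iff.2 (by simp [hv.eq_iff])) (isArcSeq_three_iff.2 (by simp [hv.eq_iff]))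
  have : v 0 = v 3 := (hφ 0).symm.trans (hφ 3)
  simp [hv.eq_iff] at this

/-- A permutation of each part, as an automorphism of the complete bipartite graph. -/
def bipartiteIso {n : ℕ} (σ τ : Equiv.Perm (Fin n)) :
    completeBipartiteGraph (Fin n) (Fin n) ≃g completeBipartiteGraph (Fin n) (Fin n) where
  toEquiv := Equiv.sumCongr σ τ
  map_rel_iff' := by rintro (a | a) (b | b) <;> simp

/-- Exchanging the two parts, as an automorphism of the complete bipartite graph. -/
def bipartiteSwap (n : ℕ) :
    completeBipartiteGraph (Fin n) (Fin n) ≃g completeBipartiteGraph (Fin n) (Fin n) where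
  toEquiv := Equiv.sumComm _ _
  map_rel_iff' := by rintro (a | a) (b | b) <;> simp

lemma vertexTransitive_bipartite (n : ℕ) :
    VertexTransitive (completeBipartiteGraph (Fin n) (Fin n)) := by
  rintro (a | a) (b | b)
  · exact ⟨bipartiteIso (Equiv.swap a b) 1, by simp [bipartiteIso]⟩
  · exact ⟨(bipartiteIso (Equiv.swap a b) 1).trans (bipartiteSwap n), by
      simp [bipartiteIso, bipartiteSwap]⟩
  · exact ⟨(bipartiteIso 1 (Equiv.swap a b)).trans (bipartiteSwap n), by
      simp [bipartiteIso, bipartiteSwap]⟩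
  · exact ⟨bipartiteIso 1 (Equiv.swap a b), by simp [bipartiteIso]⟩

/-- Up to exchanging the parts, a `3`-arc of `K_{n,n}` is determined by two distinct vertices in
each part, and both pairs can be moved independently. -/
lemma arcTransitive_three_bipartite (n : ℕ) :
    ArcTransitive (completeBipartiteGraph (Fin n) (Fin n)) 3 := by
  refine ⟨vertexTransitive_bipartite n, ?_⟩
  have key : ∀ u : Fin 4 → Fin n ⊕ Fin n, IsArcSeq (completeBipartiteGraph (Fin n) (Fin n)) 3 u →
      ∃ φ : completeBipartiteGraph (Fin n) (Fin n) ≃g completeBipartiteGraph (Fin n) (Fin n),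
      ∃ a b c d : Fin n, a ≠ c ∧ b ≠ d ∧ φ (u 0) = .inl a ∧ φ (u 1) = .inr b ∧
        φ (u 2) = .inl c ∧ φ (u 3) = .inr d := by
    intro u hu
    have h01 := hu.1 0
    have h12 := hu.1 1
    have h23 := hu.1 2
    have h02 := hu.2 0 2 rfl
    have h13 := hu.2 1 3 rfl
    simp only [Fin.castSucc_zero, Fin.succ_zero_eq_one, Fin.castSucc_one, Fin.succ_one_eq_two,
      show (2 : Fin 3).castSucc = 2 from rfl, show (2 : Fin 3).succ = 3 from rfl] at h01 h12 h23
    rcases h0 : u 0 with a | a <;> rcases h1 : u 1 with b | b <;> rcases h2 : u 2 with c | c <;>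
      rcases h3 : u 3 with d | d <;> simp_all
    · exact ⟨Iso.refl, by simp; tauto⟩
    · exact ⟨bipartiteSwap n, by simp [bipartiteSwap]; tauto⟩
  intro u v hu hv
  obtain ⟨φ, a, b, c, d, hac, hbd, h0, h1, h2, h3⟩ := key u hu
  obtain ⟨ψ, a', b', c', d', hac', hbd', h0', h1', h2', h3'⟩ := key v hv
  obtain ⟨σ, hσ⟩ := exists_perm_two hac hac'
  obtain ⟨τ, hτ⟩ := exists_perm_two hbd hbd'
  refine ⟨(φ.trans (bipartiteIso σ τ)).trans ψ.symm, fun i => ?_⟩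
  simp only [RelIso.trans_apply]
  rw [RelIso.symm_apply_eq]
  fin_cases i <;> simp [h0, h1, h2, h3, h0', h1', h2', h3', bipartiteIso, hσ, hτ]

lemma not_arcTransitive_four_bipartite {n : ℕ} (hn : 3 ≤ n) :
    ¬ ArcTransitive (completeBipartiteGraph (Fin n) (Fin n)) 4 := by
  intro h
  let v (k : Fin 3) : Fin n := Fin.castLE hn k
  have hv : Function.Injective v := Fin.castLE_injective hn
  obtain ⟨φ, hφ⟩ := h.2 ![.inl (v 0), .inr (v 0), .inl (v 1), .inr (v 1), .inl (v 0)]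
    ![.inl (v 0), .inr (v 0), .inl (v 1), .inr (v 1), .inl (v 2)]
    (isArcSeq_four_iff.2 (by simp [hv.eq_iff])) (isArcSeq_four_iff.2 (by simp [hv.eq_iff]))
  have : (.inl (v 0) : Fin n ⊕ Fin n) = .inl (v 2) := (hφ 0).symm.trans (hφ 4)
  simp [hv.eq_iff] at this

section MinusMatching

variable {n : ℕ}

@[simp] lemma bipartiteMinusMatching_inl_inl (i j : Fin n) :
    ¬ (bipartiteMinusMatching n).Adj (.inl i) (.inl j) := by
  simp [bipartiteMinusMatching]

@[simp] lemma bipartiteMinusMatching_inr_inr (i j : Fin n) :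
    ¬ (bipartiteMinusMatching n).Adj (.inr i) (.inr j) := by
  simp [bipartiteMinusMatching]

@[simp] lemma bipartiteMinusMatching_inl_inr (i j : Fin n) :
    (bipartiteMinusMatching n).Adj (.inl i) (.inr j) ↔ i ≠ j := by
  simp [bipartiteMinusMatching, eq_comm]

@[simp] lemma bipartiteMinusMatching_inr_inl (i j : Fin n) :
    (bipartiteMinusMatching n).Adj (.inr i) (.inl j) ↔ i ≠ j := by
  rw [adj_comm, bipartiteMinusMatching_inl_inr, ne_comm]

/-- A permutation acting simultaneously on both parts, as an automorphism of `K_{n,n} - nK₂`. -/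
def minusMatchingIso (σ : Equiv.Perm (Fin n)) :
    bipartiteMinusMatching n ≃g bipartiteMinusMatching n where
  toEquiv := Equiv.sumCongr σ σ
  map_rel_iff' := by rintro (a | a) (b | b) <;> simp

/-- Exchanging the two parts, as an automorphism of `K_{n,n} - nK₂`. -/
def minusMatchingSwap (n : ℕ) :
    bipartiteMinusMatching n ≃g bipartiteMinusMatching n where
  toEquiv := Equiv.sumComm _ _
  map_rel_iff' := by rintro (a | a) (b | b) <;> simp

lemma vertexTransitive_bipartiteMinusMatching (n : ℕ) :
    VertexTransitive (bipartiteMinusMatching n) := by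
  rintro (a | a) (b | b)
  · exact ⟨minusMatchingIso (Equiv.swap a b), by simp [minusMatchingIso]⟩
  · exact ⟨(minusMatchingIso (Equiv.swap a b)).trans (minusMatchingSwap n), by
      simp [minusMatchingIso, minusMatchingSwap]⟩
  · exact ⟨(minusMatchingIso (Equiv.swap a b)).trans (minusMatchingSwap n), by
      simp [minusMatchingIso, minusMatchingSwap]⟩
  · exact ⟨minusMatchingIso (Equiv.swap a b), by simp [minusMatchingIso]⟩

/-- Up to exchanging the parts, a `2`-arc of `K_{n,n} - nK₂` is given by three distinct
indices. -/
lemma arcTransitive_two_bipartiteMinusMatching (n : ℕ) :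
    ArcTransitive (bipartiteMinusMatching n) 2 := by
  have key : ∀ x y z, (bipartiteMinusMatching n).Adj x y → (bipartiteMinusMatching n).Adj y z →
      x ≠ z → ∃ φ : bipartiteMinusMatching n ≃g bipartiteMinusMatching n, ∃ a b c : Fin n,
        a ≠ b ∧ b ≠ c ∧ a ≠ c ∧ φ x = .inl a ∧ φ y = .inr b ∧ φ z = .inl c := by
    rintro (a | a) (b | b) (c | c) <;> simp
    · exact fun h1 h2 h3 => ⟨Iso.refl, by simp; tauto⟩
    · exact fun h1 h2 h3 => ⟨minusMatchingSwap n, by simp [minusMatchingSwap]; tauto⟩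
  refine arcTransitive_two_of (vertexTransitive_bipartiteMinusMatching n)
    fun x y z x' y' z' hxy hyz hxz hxy' hyz' hxz' => ?_
  obtain ⟨φ, a, b, c, hab, hbc, hac, h0, h1, h2⟩ := key x y z hxy hyz hxz
  obtain ⟨ψ, a', b', c', hab', hbc', hac', h0', h1', h2'⟩ := key x' y' z' hxy' hyz' hxz'
  obtain ⟨σ, hσ⟩ := exists_perm_three hab hbc hac hab' hbc' hac'
  refine ⟨(φ.trans (minusMatchingIso σ)).trans ψ.symm, ?_, ?_, ?_⟩ <;>
  · simp only [RelIso.trans_apply]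
    rw [RelIso.symm_apply_eq]
    simp [h0, h1, h2, h0', h1', h2', minusMatchingIso, hσ]

/-- The two ends of a `3`-arc may or may not be adjacent. -/
lemma not_arcTransitive_three_bipartiteMinusMatching (hn : 4 ≤ n) :
    ¬ ArcTransitive (bipartiteMinusMatching n) 3 := by
  intro h
  let v (k : Fin 4) : Fin n := Fin.castLE hn k
  have hv : Function.Injective v := Fin.castLE_injective hn
  obtain ⟨φ, hφ⟩ := h.2 ![.inl (v 0), .inr (v 1), .inl (v 2), .inr (v 0)]
    ![.inl (v 0), .inr (v 1), .inl (v 2), .inr (v 3)]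
    (isArcSeq_three_iff.2 (by simp [hv.eq_iff])) (isArcSeq_three_iff.2 (by simp [hv.eq_iff]))
  have h0 : φ (.inl (v 0)) = .inl (v 0) := hφ 0
  have h3 : φ (.inr (v 0)) = .inr (v 3) := hφ 3
  have := φ.map_adj_iff (v := .inl (v 0)) (w := .inr (v 0))
  simp [h0, h3, hv.eq_iff] at this

end MinusMatching

/-! ### Cayley graphs -/

section Cayley

variable {G : Type*} [Group G] {S : Set G} {h1 : (1 : G) ∉ S} {hinv : S⁻¹ = S}

lemma cay_adj {x y : G} : (Cay S h1 hinv).Adj x y ↔ y * x⁻¹ ∈ S := Iff.rfl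

lemma IsUnionOfConjClasses.conj_mem (hS : IsUnionOfConjClasses S) (g : G) {x : G} (hx : x ∈ S) :
    g * x * g⁻¹ ∈ S := by
  obtain ⟨C, rfl⟩ := hS
  simp only [Set.mem_iUnion, ConjClasses.mem_carrier_iff_mk_eq] at hx ⊢
  obtain ⟨c, hc, rfl⟩ := hx
  exact ⟨_, hc, ConjClasses.mk_eq_mk_iff_isConj.2 (isConj_iff.2 ⟨g⁻¹, by group⟩)⟩

/-- In a connected Cayley graph, a set containing `1` and stable under left multiplication by the
connection set is everything. -/
lemma mem_of_connected (hc : (Cay S h1 hinv).Connected) {P : Set G} (hP : 1 ∈ P)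
    (hmul : ∀ x ∈ P, ∀ s ∈ S, s * x ∈ P) (g : G) : g ∈ P := by
  have key : ∀ a b : G, (Cay S h1 hinv).Walk a b → a ∈ P → b ∈ P := by
    intro a b p
    induction p with
    | nil => exact id
    | @cons a c b hac _ ih =>
      intro ha
      apply ih
      simpa using hmul a ha _ (cay_adj.1 hac)
  obtain ⟨p⟩ := hc.preconnected 1 g
  exact key _ _ p hP

/-- If `H` behaves like a subgroup of index two and `c ∉ H`, the group can be enumerated as
`H ∪ cH` compatibly with translation by `c`. -/
lemma exists_sum_equiv {n : ℕ} (hcard : Nat.card G = 2 * n) (hn : 0 < n) {H : Set G}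
    (hH : ∀ a b, a * b ∈ H ↔ (a ∈ H ↔ b ∈ H)) {c : G} (hcH : c ∉ H) :
    ∃ F : Fin n ⊕ Fin n ≃ G, (∀ i, F (.inl i) ∈ H) ∧ ∀ i, F (.inr i) = c * F (.inl i) := by
  have hfin : Finite G := Nat.finite_of_card_ne_zero (by omega)
  let f : H ⊕ H → G := Sum.elim (fun x => x) (fun x => c * x)
  have hf : Function.Bijective f := by
    constructor
    · rintro (⟨a, ha⟩ | ⟨a, ha⟩) (⟨b, hb⟩ | ⟨b, hb⟩) hab
      · simpa [f] using hab
      · have := (hH c b).not.2 (by tauto)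
        simp [f] at hab
        exact absurd ha (hab ▸ this)
      · have := (hH c a).not.2 (by tauto)
        simp [f] at hab
        exact absurd hb (hab ▸ this)
      · simpa [f] using hab
    · intro g
      by_cases hg : g ∈ H
      · exact ⟨.inl ⟨g, hg⟩, rfl⟩
      · refine ⟨.inr ⟨c⁻¹ * g, ?_⟩, by simp [f]⟩
        have := hH c (c⁻¹ * g)
        simp only [mul_inv_cancel_left] at this
        tauto
  have hcH' : Nat.card H = n := by
    have := Nat.card_congr (Equiv.ofBijective f hf)
    rw [Nat.card_sum, hcard] at this
    omega
  let e : Fin n ≃ H := (Finite.equivFinOfCardEq hcH').symm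
  exact ⟨(Equiv.sumCongr e e).trans (Equiv.ofBijective f hf), fun i => (e i).2, fun i => rfl⟩

lemma nonempty_iso_bipartite {n : ℕ} (hcard : Nat.card G = 2 * n) (hn : 0 < n) {H : Set G}
    (hH : ∀ a b, a * b ∈ H ↔ (a ∈ H ↔ b ∈ H)) {c : G} (hcH : c ∉ H)
    (hSH : ∀ x, x ∈ S ↔ x ∉ H) :
    Nonempty (Cay S h1 hinv ≃g completeBipartiteGraph (Fin n) (Fin n)) := by
  obtain ⟨F, hF, hF'⟩ := exists_sum_equiv hcard hn hH hcH
  have h1H : (1 : G) ∈ H := by simpa using hH 1 1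
  have hinvH : ∀ a, a⁻¹ ∈ H ↔ a ∈ H := fun a => by
    have := hH a a⁻¹
    simp only [mul_inv_cancel] at this
    tauto
  have hr : ∀ i, F (.inr i) ∉ H := fun i => by
    rw [hF', hH]
    have := hF i
    tauto
  refine ⟨RelIso.symm ⟨F, ?_⟩⟩
  intro x y
  rw [cay_adj, hSH, hH, hinvH]
  rcases x with i | i <;> rcases y with j | j <;> simp [hF, hr]

lemma nonempty_iso_bipartiteMinusMatching {n : ℕ} (hcard : Nat.card G = 2 * n) (hn : 0 < n)
    {H : Set G} (hH : ∀ a b, a * b ∈ H ↔ (a ∈ H ↔ b ∈ H)) {c : G} (hcH : c ∉ H)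
    (hSH : ∀ x, x ∈ S ↔ x ∉ H ∧ x ≠ c) :
    Nonempty (Cay S h1 hinv ≃g bipartiteMinusMatching n) := by
  obtain ⟨F, hF, hF'⟩ := exists_sum_equiv hcard hn hH hcH
  have h1H : (1 : G) ∈ H := by simpa using hH 1 1
  have hinvH : ∀ a, a⁻¹ ∈ H ↔ a ∈ H := fun a => by
    have := hH a a⁻¹
    simp only [mul_inv_cancel] at this
    tauto
  have hr : ∀ i, F (.inr i) ∉ H := fun i => by
    rw [hF', hH]
    have := hF i
    tauto
  have hlr : ∀ i j, (Cay S h1 hinv).Adj (F (.inl i)) (F (.inr j)) ↔ i ≠ j := fun i j => by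
    rw [cay_adj, hSH, hH, hinvH]
    have : F (.inr j) * (F (.inl i))⁻¹ = c ↔ i = j := by
      rw [hF', mul_inv_eq_iff_eq_mul, mul_right_inj, F.injective.eq_iff, Sum.inl.injEq, eq_comm]
    simp [hF, hr, this]
  refine ⟨RelIso.symm ⟨F, ?_⟩⟩
  intro x y
  rcases x with i | i <;> rcases y with j | j
  · rw [cay_adj, hSH, hH, hinvH]
    simp [hF]
  · simp [hlr]
  · rw [adj_comm, hlr]
    simp [eq_comm]
  · rw [cay_adj, hSH, hH, hinvH]
    simp [hr]

end Cayley

/-! ### Normal Cayley graphs on dihedral groups -/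

section Dihedral

open DihedralGroup

lemma even_or_even_sub_one {n : ℕ} [NeZero n] (a : ZMod n) : Even a ∨ Even (a - 1) := by
  rcases Nat.even_or_odd' a.val with ⟨k, hk | hk⟩
  · left
    refine ⟨k, ?_⟩
    rw [← ZMod.natCast_zmod_val a, hk]
    push_cast
    ring
  · right
    refine ⟨k, ?_⟩
    rw [← ZMod.natCast_zmod_val a, hk]
    push_cast
    ring

/-- The even elements form a subgroup of index at most two of `ZMod n`. -/
lemma even_sub_of_not_even {n : ℕ} [NeZero n] {a b : ZMod n} (ha : ¬ Even a) (hb : ¬ Even b) :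
    Even (a - b) := by
  have := ((even_or_even_sub_one a).resolve_left ha).sub ((even_or_even_sub_one b).resolve_left hb)
  simpa using this

lemma even_add_iff {n : ℕ} [NeZero n] (a b : ZMod n) :
    Even (a + b) ↔ (Even a ↔ Even b) := by
  have h1 : Even (a + b) → Even a → Even b := fun h h' => by simpa using h.sub h'
  have h2 : Even (a + b) → Even b → Even a := fun h h' => by simpa using h.sub h'
  have h3 : Even a → Even b → Even (a + b) := Even.add
  have h4 : ¬ Even a → ¬ Even b → Even (a + b) := fun h h' => by
    simpa using even_sub_of_not_even h (b := -b) (by simpa using h')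
  tauto

variable {n : ℕ} {S : Set (DihedralGroup n)}

/-- Conjugate reflections differ by an even rotation. -/
lemma sr_mem_of_even_sub (hconj : ∀ g, ∀ x ∈ S, g * x * g⁻¹ ∈ S) {i j : ZMod n}
    (hi : sr i ∈ S) (hij : Even (j - i)) : sr j ∈ S := by
  obtain ⟨k, hk⟩ := hij
  have := hconj (r (-k)) _ hi
  simp only [r_mul_sr, inv_r, sr_mul_r] at this
  rwa [show i - -k + - -k = j by linear_combination -hk] at this

variable {h1 : (1 : DihedralGroup n) ∉ S} {hinv : S⁻¹ = S}

lemma exists_sr_mem (hc : (Cay S h1 hinv).Connected) : ∃ i, sr i ∈ S := by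
  by_contra! h
  have : sr (0 : ZMod n) ∈ Set.range (r : ZMod n → DihedralGroup n) := by
    refine mem_of_connected hc (P := Set.range r) ⟨0, rfl⟩ ?_ _
    rintro _ ⟨i, rfl⟩ (j | j) hj
    · exact ⟨j + i, by simp⟩
    · exact absurd hj (h j)
  simp at this

lemma exists_adj_ne (hn : 3 ≤ n) (hconj : ∀ g, ∀ x ∈ S, g * x * g⁻¹ ∈ S)
    (hc : (Cay S h1 hinv).Connected) (x y : DihedralGroup n) :
    ∃ z, (Cay S h1 hinv).Adj x z ∧ z ≠ y := by
  obtain ⟨i, hi⟩ := exists_sr_mem hc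
  have hi' : sr (i + 2) ∈ S := sr_mem_of_even_sub hconj hi ⟨1, by ring⟩
  by_cases h : sr i * x = y
  · refine ⟨sr (i + 2) * x, by simpa [cay_adj] using hi', fun h' => ?_⟩
    have h2 : ((2 : ℕ) : ZMod n) = 0 := by simpa using h'.trans h.symm
    rw [ZMod.natCast_eq_zero_iff] at h2
    exact absurd (Nat.le_of_dvd two_pos h2) (by omega)
  · exact ⟨sr i * x, by simpa [cay_adj] using hi, h⟩

/-- Suppose that the connection set consists of the reflections outside the index-two set
`H = {r i | i even} ∪ {sr i | i - i₀ even}` and of at least one odd rotation. Then, given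
`2`-arc-transitivity, it misses no two odd rotations that differ by an even rotation `r z ≠ 1`.

The vertices `1` and `sr i₀` together dominate all of the complement of `H`. An automorphism
fixing `1` takes any even rotation `r z ≠ 1` to `sr i₀`, so by counting `1` and `r z` do too. -/
lemma mem_or_mem_of_arcTransitive [NeZero n] (h2 : ArcTransitive (Cay S h1 hinv) 2)
    {i₀ i₁ k : ZMod n} (hodd : ¬ Even (i₁ - i₀)) (hsr : ∀ i, sr i ∈ S ↔ ¬ Even (i - i₀))
    (hr : ∀ i, r i ∈ S → ¬ Even i) (hk : r k ∈ S) {i z : ZMod n} (hi : ¬ Even i) (hz : Even z)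
    (hz0 : z ≠ 0) : r i ∈ S ∨ r (i - z) ∈ S := by
  let C : Set (DihedralGroup n) :=
    {x | (∃ i, x = r i ∧ ¬ Even i) ∨ ∃ i, x = sr i ∧ ¬ Even (i - i₀)}
  obtain ⟨φ, hφ0, -, hφ2⟩ : ∃ φ : Cay S h1 hinv ≃g Cay S h1 hinv,
      φ 1 = 1 ∧ φ (sr i₁) = r k ∧ φ (r z) = sr i₀ := by
    refine h2.exists_two ?_ ?_ ?_ ?_ ?_ ?_
    · simpa [cay_adj, hsr] using hodd
    · simp only [cay_adj, inv_sr, r_mul_sr, hsr]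
      rwa [show i₁ - z - i₀ = (i₁ - i₀) + -z by ring, even_add_iff, even_neg, iff_true_right hz]
    · exact fun h => hz0 (r.inj h).symm
    · simpa [cay_adj] using hk
    · simpa [cay_adj, hsr] using hr k hk
    · exact fun h => nomatch (h : r 0 = sr i₀)
  let N (x : DihedralGroup n) : Set (DihedralGroup n) :=
    {y | (Cay S h1 hinv).Adj 1 y ∨ (Cay S h1 hinv).Adj x y}
  have hNC : N (r z) ⊆ C := by
    rintro (j | j) (hj | hj) <;>
      simp only [cay_adj, inv_one, mul_one, inv_r, r_mul_r, sr_mul_r] at hj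
    · exact .inl ⟨j, rfl, hr j hj⟩
    · refine .inl ⟨j, rfl, ?_⟩
      have := hr _ hj
      rwa [even_add_iff, even_neg, iff_true_right hz] at this
    · exact .inr ⟨j, rfl, (hsr j).1 hj⟩
    · refine .inr ⟨j, rfl, ?_⟩
      have := (hsr _).1 hj
      rwa [show j + -z - i₀ = (j - i₀) + -z by ring, even_add_iff, even_neg, iff_true_right hz]
        at this
  have hCN : C ⊆ N (sr i₀) := by
    rintro _ (⟨j, rfl, hj⟩ | ⟨j, rfl, hj⟩)
    · right
      simp only [cay_adj, inv_sr, r_mul_sr, hsr]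
      simpa using hj
    · left
      simpa [cay_adj, hsr] using hj
  have himg : φ '' N (r z) = N (sr i₀) := by
    ext y
    constructor
    · rintro ⟨x, hx, rfl⟩
      refine hx.imp (fun h => ?_) fun h => ?_
      · rw [← hφ0]
        exact φ.map_adj_iff.2 h
      · rw [← hφ2]
        exact φ.map_adj_iff.2 h
    · intro hy
      refine ⟨φ.symm y, hy.imp (fun h => ?_) (fun h => ?_), φ.apply_symm_apply y⟩
      · rw [← φ.map_adj_iff, hφ0, φ.apply_symm_apply]
        exact h
      · rw [← φ.map_adj_iff, hφ2, φ.apply_symm_apply]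
        exact h
  have hle : C.ncard ≤ (N (r z)).ncard := by
    rw [← Set.ncard_image_of_injective (N (r z)) φ.injective, himg]
    exact Set.ncard_le_ncard hCN
  have hmem : r i ∈ N (r z) := by
    rw [Set.eq_of_subset_of_ncard_le hNC hle]
    exact .inl ⟨i, rfl, hi⟩
  simpa [N, cay_adj, sub_eq_add_neg] using hmem

theorem classification_of_arcTransitive_two (hn : 3 ≤ n)
    (hconj : ∀ g, ∀ x ∈ S, g * x * g⁻¹ ∈ S) (hc : (Cay S h1 hinv).Connected)
    (h2 : ArcTransitive (Cay S h1 hinv) 2) :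
    Nonempty (Cay S h1 hinv ≃g completeGraph (Fin (2 * n))) ∨
      Nonempty (Cay S h1 hinv ≃g completeBipartiteGraph (Fin n) (Fin n)) ∨
      (4 ≤ n ∧ Nonempty (Cay S h1 hinv ≃g bipartiteMinusMatching n)) := by
  have : NeZero n := ⟨by omega⟩
  have hcard : Nat.card (DihedralGroup n) = 2 * n := DihedralGroup.nat_card
  by_cases htri : ∃ a ∈ S, ∃ b ∈ S, b * a ∈ S
  · left
    obtain ⟨a, ha, b, hb, hba⟩ := htri
    have htop : Cay S h1 hinv = ⊤ := h2.eq_top_of_triangle hc (x := 1) (y := a) (z := b * a)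
      (by simpa [cay_adj] using ha) (by simpa [cay_adj] using hb) (by simpa [cay_adj] using hba)
    rw [htop]
    exact ⟨Iso.completeGraph (Finite.equivFinOfCardEq hcard)⟩
  right
  push Not at htri
  by_cases hall : ∀ i, sr i ∈ S
  · -- Every rotation is a product of two reflections, so `S` contains no rotation.
    left
    refine nonempty_iso_bipartite hcard (by omega) (H := Set.range r) (c := sr 0) ?_ (by simp) ?_
    · rintro (a | a) (b | b) <;> simp
    · rintro (a | a)
      · simpa using htri _ (hall a) _ (hall 0)
      · simpa using hall a
  push Not at hall
  obtain ⟨i₀, hi₀⟩ := hall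
  obtain ⟨i₁, hi₁⟩ := exists_sr_mem hc
  have hodd : ¬ Even (i₁ - i₀) := fun h => hi₀ (sr_mem_of_even_sub hconj hi₁ (by
    rw [← neg_sub]
    exact h.neg))
  have hsr : ∀ i, sr i ∈ S ↔ ¬ Even (i - i₀) := fun i => by
    refine ⟨fun hi h => hi₀ (sr_mem_of_even_sub hconj hi (by rw [← neg_sub]; exact h.neg)),
      fun h => sr_mem_of_even_sub hconj hi₁ ?_⟩
    simpa using even_sub_of_not_even h hodd
  have hr : ∀ i, r i ∈ S → ¬ Even i := fun i hi he => by
    refine htri (sr (i₁ + i)) ((hsr _).2 ?_) (sr i₁) hi₁ (by simpa using hi)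
    rwa [show i₁ + i - i₀ = (i₁ - i₀) + i by ring, even_add_iff, iff_true_right he]
  -- Otherwise `S` would lie in the proper subgroup of even rotations and reflections of `S`.
  obtain ⟨k, hk⟩ : ∃ k, r k ∈ S := by
    by_contra! h
    have hmem : sr i₀ ∈ {x : DihedralGroup n | (∃ i, x = r i ∧ Even i) ∨
        ∃ i, x = sr i ∧ ¬ Even (i - i₀)} := by
      refine mem_of_connected hc (Or.inl ⟨0, rfl, Even.zero⟩) ?_ _
      rintro _ (⟨i, rfl, hi⟩ | ⟨i, rfl, hi⟩) (j | j) hj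
      · exact absurd hj (h j)
      · refine .inr ⟨j + i, by simp, ?_⟩
        have := (hsr j).1 hj
        rwa [show j + i - i₀ = (j - i₀) + i by ring, even_add_iff, iff_true_right hi]
      · exact absurd hj (h j)
      · refine .inl ⟨i - j, by simp, ?_⟩
        simpa using even_sub_of_not_even hi ((hsr j).1 hj)
    simp at hmem
  have hmiss : ∀ i z : ZMod n, ¬ Even i → Even z → z ≠ 0 → r i ∈ S ∨ r (i - z) ∈ S :=
    fun i z => mem_or_mem_of_arcTransitive h2 hodd hsr hr hk
  have hn4 : 4 ≤ n := by
    by_contra hlt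
    obtain rfl : n = 3 := by omega
    exact hodd ((by decide : ∀ a : ZMod 3, ∃ b, a = b + b) _)
  let H : Set (DihedralGroup n) := {x | (∃ i, x = r i ∧ Even i) ∨ ∃ i, x = sr i ∧ Even (i - i₀)}
  have hHr : ∀ i, r i ∈ H ↔ Even i := fun i => by simp [H]
  have hHsr : ∀ i, sr i ∈ H ↔ Even (i - i₀) := fun i => by simp [H]
  have hH : ∀ a b, a * b ∈ H ↔ (a ∈ H ↔ b ∈ H) := by
    rintro (a | a) (b | b)
    · simp only [r_mul_r, hHr, even_add_iff]
    · simp only [r_mul_sr, hHr, hHsr]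
      rw [show b - a - i₀ = -a + (b - i₀) by ring, even_add_iff, even_neg]
    · simp only [sr_mul_r, hHr, hHsr]
      rw [show a + b - i₀ = (a - i₀) + b by ring, even_add_iff]
    · simp only [sr_mul_sr, hHr, hHsr]
      rw [show b - a = -(a - i₀) + (b - i₀) by ring, even_add_iff, even_neg]
  by_cases hfull : ∀ i, ¬ Even i → r i ∈ S
  · left
    refine nonempty_iso_bipartite hcard (by omega) hH (c := sr i₁) (by rwa [hHsr]) ?_
    rintro (a | a)
    · rw [hHr]
      exact ⟨hr a, hfull a⟩
    · rw [hHsr, hsr]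
  · right
    push Not at hfull
    obtain ⟨c, hce, hcS⟩ := hfull
    refine ⟨hn4, nonempty_iso_bipartiteMinusMatching hcard (by omega) hH (c := r c)
      (by rwa [hHr]) ?_⟩
    rintro (a | a)
    · rw [hHr]
      refine ⟨fun ha => ⟨hr a ha, by rintro h; exact hcS (h ▸ ha)⟩, fun ⟨hae, hne⟩ => ?_⟩
      have := hmiss a (a - c) hae (even_sub_of_not_even hae hce)
        (fun h => hne (by rw [sub_eq_zero.1 h]))
      rw [sub_sub_cancel] at this
      exact this.resolve_right hcS
    · simp [hHsr, hsr]

end Dihedral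

/-- Transport of a Cayley graph along a group isomorphism. -/
def cayIso {G G' : Type*} [Group G] [Group G'] (f : G ≃* G') {S : Set G} {h1 : (1 : G) ∉ S}
    {hinv : S⁻¹ = S} (h1' : (1 : G') ∉ f.symm ⁻¹' S) (hinv' : (f.symm ⁻¹' S)⁻¹ = f.symm ⁻¹' S) :
    Cay S h1 hinv ≃g Cay (f.symm ⁻¹' S) h1' hinv' where
  toEquiv := f.toEquiv
  map_rel_iff' := by simp [cay_adj]

end InnerCayley

open InnerCayley in
theorem corollary1p2 {G : Type*} [Group G] (n : ℕ) (hn : 3 ≤ n)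
    (hG : Nonempty (G ≃* DihedralGroup n))
    (S : Set G) (h1 : (1 : G) ∉ S) (hinv : S⁻¹ = S)
    (hS : InnerCayley.IsUnionOfConjClasses S)
    (hconn : (InnerCayley.Cay S h1 hinv).Connected) :
    (∀ s : ℕ, 4 ≤ s → ¬ InnerCayley.ArcTransitive (InnerCayley.Cay S h1 hinv) s) ∧
    (InnerCayley.ArcTransitive (InnerCayley.Cay S h1 hinv) 3 ↔
      Nonempty (InnerCayley.Cay S h1 hinv ≃g completeBipartiteGraph (Fin n) (Fin n))) ∧
    (InnerCayley.ArcTransitive (InnerCayley.Cay S h1 hinv) 2 ↔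
      Nonempty (InnerCayley.Cay S h1 hinv ≃g SimpleGraph.completeGraph (Fin (2 * n))) ∨
      Nonempty (InnerCayley.Cay S h1 hinv ≃g completeBipartiteGraph (Fin n) (Fin n)) ∨
      (4 ≤ n ∧
        Nonempty (InnerCayley.Cay S h1 hinv ≃g InnerCayley.bipartiteMinusMatching n))) := by
  obtain ⟨f⟩ := hG
  have h1' : (1 : DihedralGroup n) ∉ f.symm ⁻¹' S := by simpa using h1
  have hinv' : (f.symm ⁻¹' S)⁻¹ = f.symm ⁻¹' S := by
    ext x
    rw [Set.mem_inv, Set.mem_preimage, map_inv, ← Set.mem_inv, hinv, Set.mem_preimage]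
  let e := cayIso (h1 := h1) (hinv := hinv) f h1' hinv'
  have hconj : ∀ g, ∀ x ∈ f.symm ⁻¹' S, g * x * g⁻¹ ∈ f.symm ⁻¹' S := fun g x hx => by
    simpa using hS.conj_mem (f.symm g) hx
  have hconn' := e.connected_iff.1 hconn
  have hdeg : ∀ x y : G, ∃ z, (Cay S h1 hinv).Adj x z ∧ z ≠ y := fun x y => by
    obtain ⟨z, hz, hne⟩ := exists_adj_ne hn hconj hconn' (e x) (e y)
    refine ⟨e.symm z, ?_, fun h => hne (by rw [← h, e.apply_symm_apply])⟩
    rw [← e.map_adj_iff, e.apply_symm_apply]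
    exact hz
  have hclass : ArcTransitive (Cay S h1 hinv) 2 →
      Nonempty (Cay S h1 hinv ≃g SimpleGraph.completeGraph (Fin (2 * n))) ∨
      Nonempty (Cay S h1 hinv ≃g completeBipartiteGraph (Fin n) (Fin n)) ∨
      (4 ≤ n ∧ Nonempty (Cay S h1 hinv ≃g bipartiteMinusMatching n)) := fun h =>
    (classification_of_arcTransitive_two hn hconj hconn' (h.congr e)).imp
      (fun ⟨t⟩ => ⟨e.trans t⟩)
      (Or.imp (fun ⟨t⟩ => ⟨e.trans t⟩) (And.imp_right fun ⟨t⟩ => ⟨e.trans t⟩))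
  have hthree : ArcTransitive (Cay S h1 hinv) 3 →
      Nonempty (Cay S h1 hinv ≃g completeBipartiteGraph (Fin n) (Fin n)) := fun h => by
    rcases hclass (h.mono hdeg (by norm_num)) with ⟨⟨t⟩⟩ | ht | ⟨hn4, ⟨t⟩⟩
    · exact absurd (h.congr t) (not_arcTransitive_three_completeGraph (by omega))
    · exact ht
    · exact absurd (h.congr t) (not_arcTransitive_three_bipartiteMinusMatching hn4)
  have hthree' : Nonempty (Cay S h1 hinv ≃g completeBipartiteGraph (Fin n) (Fin n)) →
      ArcTransitive (Cay S h1 hinv) 3 := fun ⟨t⟩ => (arcTransitive_three_bipartite n).congr t.symm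
  refine ⟨fun s hs h => ?_, ⟨hthree, hthree'⟩, hclass, ?_⟩
  · have h4 : ArcTransitive (Cay S h1 hinv) 4 := h.mono hdeg hs
    obtain ⟨t⟩ := hthree (h4.mono hdeg (by norm_num))
    exact not_arcTransitive_four_bipartite hn (h4.congr t)
  · rintro (⟨⟨t⟩⟩ | ht | ⟨-, ⟨t⟩⟩)
    · exact arcTransitive_two_top.congr t.symm
    · exact (hthree' ht).mono hdeg (by norm_num)
    · exact (arcTransitive_two_bipartiteMinusMatching n).congr t.symm
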